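/- Let $\mathfrak g$ be a complex Lie algebra with a triangular decomposition in the sense of Moody and Pianzola, that is: - $\mathfrak g=\mathfrak n_-\oplus\mathfrak h\oplus\mathfrak n_+$ as a vector space, with subalgebras $\mathfrak n_\pm$ and an abelian subalgebra $\mathfrak h$; - $\mathfrak n_+$ is the direct sum of its weight spaces $(\mathfrak n_+)_\alpha$ for the adjoint action of $\mathfrak h$, and all its weights are nonzero elements of a free additive semigroup $Q_+\subset\mathfrak h^*$ that has a basis consisting of linearly independent elements of $\mathfrak h^*$; - there is an anti-involution $\sigma$ of $\mathfrak g$ (a linear bijection with $\sigma([x,y])=[\sigma(y),\sigma(x)]$ and $\sigma^2=\mathrm{id}$) with $\sigma|_{\mathfrak h}=\mathrm{id}$ and $\sigma(\mathfrak n_+)=\mathfrak n_-$. Assume that all root spaces $(\mathfrak n_+)_\alpha$ are finite dimensional, and put $\mathfrak n=\mathfrak n_+$. For $\mu\in\mathfrak h^*$ let $$M(\mu)=U(\mathfrak g)\otimes_{U(\mathfrak h\oplus\mathfrak n_+)}\mathbb C_\mu$$ be the Verma module, where $(h+n)v=\mu(h)v$ for $h\in\mathfrak h$, $n\in\mathfrak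 n_+$, $v\in\mathbb C_\mu$, and let $$\overline{M(\mu)}=\prod_{\nu\in\mathfrak h^*}M(\mu)_\nu$$ be its weight completion with the induced $\mathfrak g$-module structure: $(xf)_\nu=\sum_\alpha x_\alpha f_{\nu-\alpha}$ for $x=\sum_\alpha x_\alpha$ with $x_\alpha\in\mathfrak g_\alpha$. For a character $\lambda\in(\mathfrak n/[\mathfrak n,\mathfrak n])^*$, i.e. a Lie algebra homomorphism $\mathfrak n\to\mathbb C$, and a $\mathfrak g$-module $M$ let $$W_\lambda(M)=\{v\in M : xv=\lambda(x)v \text{ for all } x\in\mathfrak n\}$$ be the $\mathfrak n$-submodule of $\lambda$-Whittaker vectors. **Theorem.** If $\mu\in\mathfrak h^*$ is such that $M(\mu)$ is a simple $\mathfrak g$-module, then for every character $\lambda$ of $\mathfrak n$ we have $\dim W_\lambda(\overline{M(\mu)})=1$; in particular, $W_\lambda(\overline{M(\mu)})$ is a simple $\mathfrak n$-module. -/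

import Mathlib

open scoped TensorProduct

attribute [local instance 100] LieRing.ofAssociativeRing

noncomputable section

universe u v

/-- A triangular decomposition `𝔤 = 𝔫₋ ⊕ 𝔥 ⊕ 𝔫₊` of a complex Lie algebra in the sense of
Moody and Pianzola. -/
structure TriangularDecomposition (𝔤 : Type u) [LieRing 𝔤] [LieAlgebra ℂ 𝔤] where
  /-- the Cartan subalgebra `𝔥` -/
  h : LieSubalgebra ℂ 𝔤
  /-- the positive part `𝔫₊` -/
  nPos : LieSubalgebra ℂ 𝔤
  /-- the negative part `𝔫₋` -/
  nNeg : LieSubalgebra ℂ 𝔤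
  /-- `𝔥` is abelian -/
  [abelian : IsLieAbelian h]
  /-- `𝔤 = 𝔫₋ ⊕ 𝔥 ⊕ 𝔫₊` as vector spaces -/
  isInternal : DirectSum.IsInternal ![nNeg.toSubmodule, h.toSubmodule, nPos.toSubmodule]
  /-- the basis of the free additive semigroup `Q₊ ⊆ 𝔥*` -/
  base : Set (Module.Dual ℂ h)
  /-- this basis consists of linearly independent elements of `𝔥*` -/
  base_linearIndependent : LinearIndependent ℂ (fun α : base => (α : Module.Dual ℂ h))
  /-- `𝔫₊` is the sum of its weight spaces for the adjoint action of `𝔥`,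
  for weights which are nonzero elements of `Q₊` -/
  nPos_eq : nPos.toSubmodule =
    ⨆ α ∈ {α : Module.Dual ℂ h | α ∈ AddSubmonoid.closure base ∧ α ≠ 0},
      (LieModule.weightSpace 𝔤 (α : h → ℂ)).toSubmodule ⊓ nPos.toSubmodule
  /-- the anti-involution `σ` of `𝔤` -/
  σ : 𝔤 ≃ₗ[ℂ] 𝔤
  σ_lie : ∀ x y : 𝔤, σ ⁅x, y⁆ = ⁅σ y, σ x⁆
  σ_σ : ∀ x : 𝔤, σ (σ x) = x
  σ_h : ∀ x ∈ h, σ x = x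
  σ_nPos : nPos.toSubmodule.map (σ : 𝔤 →ₗ[ℂ] 𝔤) = nNeg.toSubmodule

namespace TriangularDecomposition

variable {𝔤 : Type u} [LieRing 𝔤] [LieAlgebra ℂ 𝔤] (T : TriangularDecomposition 𝔤)

instance : IsLieAbelian T.h := T.abelian

/-- The weight space `M_ν = {m | x m = ν(x) m for all x ∈ 𝔥}` of a `𝔤`-module `M`. -/
abbrev weightSpace (M : Type v) [AddCommGroup M] [Module ℂ M] [LieRingModule 𝔤 M]
    [LieModule ℂ 𝔤 M] (ν : Module.Dual ℂ T.h) : Submodule ℂ M :=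
  (LieModule.weightSpace M (ν : T.h → ℂ)).toSubmodule

/-! ### The root space decomposition of `𝔤` -/

theorem mem_weightSpace {M : Type v} [AddCommGroup M] [Module ℂ M] [LieRingModule 𝔤 M]
    [LieModule ℂ 𝔤 M] {ν : Module.Dual ℂ T.h} {m : M} :
    m ∈ T.weightSpace M ν ↔ ∀ x : T.h, ⁅(x : 𝔤), m⁆ = ν x • m :=
  LieModule.mem_weightSpace _ m

theorem lie_mem_weightSpace {M : Type v} [AddCommGroup M] [Module ℂ M] [LieRingModule 𝔤 M]
    [LieModule ℂ 𝔤 M] {α ν : Module.Dual ℂ T.h} {x : 𝔤} {m : M}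
    (hx : x ∈ T.weightSpace 𝔤 α) (hm : m ∈ T.weightSpace M ν) :
    ⁅x, m⁆ ∈ T.weightSpace M (α + ν) := by
  rw [mem_weightSpace] at *
  intro y
  rw [leibniz_lie, hx y, hm y, smul_lie, lie_smul, LinearMap.add_apply, add_smul]

theorem iSup_triple : T.nNeg.toSubmodule ⊔ (T.h.toSubmodule ⊔ T.nPos.toSubmodule) = ⊤ := by
  have := T.isInternal.submodule_iSup_eq_top
  rw [iSup_fin_three] at this
  simpa [sup_assoc] using this

theorem isCompl_h : IsCompl T.h.toSubmodule (T.nNeg.toSubmodule ⊔ T.nPos.toSubmodule) := by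
  have := T.isInternal.submodule_iSupIndep 1
  refine ⟨this.mono_right ?_, ?_⟩
  · refine sup_le ?_ ?_
    · exact le_iSup₂_of_le (0 : Fin 3) (by decide) le_rfl
    · exact le_iSup₂_of_le (2 : Fin 3) (by decide) le_rfl
  · rw [codisjoint_iff, sup_left_comm, iSup_triple]

theorem h_le_weightSpace : T.h.toSubmodule ≤ T.weightSpace 𝔤 0 := by
  intro x hx
  rw [mem_weightSpace]
  intro y
  have := congrArg Subtype.val (trivial_lie_zero T.h T.h y ⟨x, hx⟩)
  simpa using this

theorem nPos_le_iSup : T.nPos.toSubmodule ≤ ⨆ α, T.weightSpace 𝔤 α := by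
  rw [T.nPos_eq]
  exact iSup₂_le fun α _ => inf_le_left.trans (le_iSup (fun α => T.weightSpace 𝔤 α) α)

theorem σ_mem_weightSpace {α : Module.Dual ℂ T.h} {x : 𝔤} (hx : x ∈ T.weightSpace 𝔤 α) :
    T.σ x ∈ T.weightSpace 𝔤 (-α) := by
  rw [mem_weightSpace] at *
  intro y
  have h1 := T.σ_lie x (y : 𝔤)
  rw [T.σ_h y y.2, ← lie_skew, hx y] at h1
  rw [← h1]
  simp

theorem nNeg_le_iSup : T.nNeg.toSubmodule ≤ ⨆ α, T.weightSpace 𝔤 α := by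
  rw [← T.σ_nPos, Submodule.map_le_iff_le_comap]
  refine T.nPos_le_iSup.trans (iSup_le fun α x hx => ?_)
  exact (le_iSup (fun α => T.weightSpace 𝔤 α) (-α)) (T.σ_mem_weightSpace hx)

open scoped Classical in
/-- `𝔤` is the direct sum of its weight spaces for the adjoint action of `𝔥`. -/
theorem isInternal_weightSpace : DirectSum.IsInternal (fun α => T.weightSpace 𝔤 α) := by
  refine DirectSum.isInternal_submodule_of_iSupIndep_of_iSup_eq_top ?_ ?_
  · have h1 := LieSubmodule.iSupIndep_toSubmodule.mpr (LieModule.iSupIndep_genWeightSpace ℂ T.h 𝔤)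
    have h2 := h1.comp (f := fun α : Module.Dual ℂ T.h => (α : T.h → ℂ)) DFunLike.coe_injective
    exact h2.mono fun α => LieModule.weightSpace_le_genWeightSpace 𝔤 (α : T.h → ℂ)
  · rw [eq_top_iff, ← T.iSup_triple]
    refine sup_le T.nNeg_le_iSup (sup_le ?_ T.nPos_le_iSup)
    exact T.h_le_weightSpace.trans (le_iSup (fun α => T.weightSpace 𝔤 α) 0)

open scoped Classical in
/-- The identification of `𝔤` with the direct sum of its weight spaces. -/
def rootDecomposition : (DirectSum (Module.Dual ℂ T.h) fun α => T.weightSpace 𝔤 α) ≃ₗ[ℂ] 𝔤 :=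
  LinearEquiv.ofBijective (DirectSum.coeLinearMap fun α => T.weightSpace 𝔤 α)
    T.isInternal_weightSpace

/-! ### Verma modules -/

theorem h_lie_nPos {x y : 𝔤} (hx : x ∈ T.h) (hy : y ∈ T.nPos) : ⁅x, y⁆ ∈ T.nPos := by
  have key : T.nPos.toSubmodule ≤
      T.nPos.toSubmodule.comap (LieModule.toEnd ℂ 𝔤 𝔤 x : 𝔤 →ₗ[ℂ] 𝔤) := by
    conv_lhs => rw [T.nPos_eq]
    refine iSup₂_le fun α _ z hz => ?_
    have := (T.mem_weightSpace.mp hz.1) ⟨x, hx⟩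
    simp only [Submodule.mem_comap, LieModule.toEnd_apply_apply]
    rw [show ⁅x, z⁆ = _ from this]
    exact T.nPos.toSubmodule.smul_mem _ hz.2
  exact key hy

theorem lie_mem_nPos {x y : 𝔤} (hx : x ∈ T.h.toSubmodule ⊔ T.nPos.toSubmodule)
    (hy : y ∈ T.h.toSubmodule ⊔ T.nPos.toSubmodule) : ⁅x, y⁆ ∈ T.nPos := by
  obtain ⟨a, ha, b, hb, rfl⟩ := Submodule.mem_sup.mp hx
  obtain ⟨c, hc, d, hd, rfl⟩ := Submodule.mem_sup.mp hy
  have h1 : ⁅a, c⁆ = 0 := by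
    simpa using congrArg Subtype.val (trivial_lie_zero T.h T.h ⟨a, ha⟩ ⟨c, hc⟩)
  have h2 : ⁅b, c⁆ ∈ T.nPos := by
    rw [← lie_skew]
    exact T.nPos.neg_mem (T.h_lie_nPos hc hb)
  rw [add_lie, lie_add, lie_add, h1, zero_add]
  exact T.nPos.add_mem (T.h_lie_nPos ha hd) (T.nPos.add_mem h2 (T.nPos.lie_mem hb hd))

/-- The subalgebra `𝔟 = 𝔥 ⊕ 𝔫₊`. -/
def borel : LieSubalgebra ℂ 𝔤 where
  __ := T.h.toSubmodule ⊔ T.nPos.toSubmodule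
  lie_mem' {_ _} hx hy :=
    (le_sup_right : T.nPos.toSubmodule ≤ T.h.toSubmodule ⊔ T.nPos.toSubmodule)
      (T.lie_mem_nPos hx hy)

/-- The projection of `𝔤 = 𝔫₋ ⊕ 𝔥 ⊕ 𝔫₊` onto `𝔥`. -/
def projH : 𝔤 →ₗ[ℂ] T.h :=
  Submodule.projectionOnto T.h.toSubmodule (T.nNeg.toSubmodule ⊔ T.nPos.toSubmodule)
    T.isCompl_h

theorem projH_nPos {x : 𝔤} (hx : x ∈ T.nPos) : T.projH x = 0 :=
  (Submodule.projectionOnto_apply_eq_zero_iff T.isCompl_h).mpr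
    ((le_sup_right : T.nPos.toSubmodule ≤ T.nNeg.toSubmodule ⊔ T.nPos.toSubmodule) hx)

/-- The character `h + n ↦ μ(h)` of `𝔟 = 𝔥 ⊕ 𝔫₊`. -/
def borelCharacter (μ : Module.Dual ℂ T.h) : LieAlgebra.LieCharacter ℂ T.borel where
  __ := (μ ∘ₗ T.projH) ∘ₗ T.borel.toSubmodule.subtype
  map_lie' {x y} := by
    have h1 : T.projH ⁅(x : 𝔤), (y : 𝔤)⁆ = 0 := T.projH_nPos (T.lie_mem_nPos x.2 y.2)
    simp [h1, LieRing.of_associative_ring_bracket, mul_comm]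

/-- The inclusion `U(𝔟) → U(𝔤)`. -/
def borelInclusion : UniversalEnvelopingAlgebra ℂ T.borel →ₐ[ℂ] UniversalEnvelopingAlgebra ℂ 𝔤 :=
  UniversalEnvelopingAlgebra.lift ℂ ((UniversalEnvelopingAlgebra.ι ℂ).comp T.borel.incl)

/-- The action `U(𝔟) → ℂ = End(ℂ_μ)` on the one-dimensional module `ℂ_μ`. -/
def borelAction (μ : Module.Dual ℂ T.h) : UniversalEnvelopingAlgebra ℂ T.borel →ₐ[ℂ] ℂ :=
  UniversalEnvelopingAlgebra.lift ℂ (T.borelCharacter μ)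

/-- The Verma module `M(μ) = U(𝔤) ⊗_{U(𝔟)} ℂ_μ`: the quotient of `U(𝔤) ⊗_ℂ ℂ` by the
elements `u b ⊗ z - u ⊗ b z` with `u ∈ U(𝔤)`, `b ∈ U(𝔟)`, `z ∈ ℂ_μ`. -/
def Verma (μ : Module.Dual ℂ T.h) : Type u :=
  (UniversalEnvelopingAlgebra ℂ 𝔤 ⊗[ℂ] ℂ) ⧸
    Submodule.span (UniversalEnvelopingAlgebra ℂ 𝔤)
      {t : UniversalEnvelopingAlgebra ℂ 𝔤 ⊗[ℂ] ℂ |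
        ∃ (w : UniversalEnvelopingAlgebra ℂ 𝔤) (b : UniversalEnvelopingAlgebra ℂ T.borel) (z : ℂ),
          t = (w * T.borelInclusion b) ⊗ₜ[ℂ] z - w ⊗ₜ[ℂ] (T.borelAction μ b * z)}

namespace Verma

variable (μ : Module.Dual ℂ T.h)

instance : AddCommGroup (T.Verma μ) :=
  inferInstanceAs (AddCommGroup ((UniversalEnvelopingAlgebra ℂ 𝔤 ⊗[ℂ] ℂ) ⧸ _))

instance : Module (UniversalEnvelopingAlgebra ℂ 𝔤) (T.Verma μ) :=
  inferInstanceAs (Module (UniversalEnvelopingAlgebra ℂ 𝔤)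
    ((UniversalEnvelopingAlgebra ℂ 𝔤 ⊗[ℂ] ℂ) ⧸ _))

instance : Module ℂ (T.Verma μ) :=
  inferInstanceAs (Module ℂ ((UniversalEnvelopingAlgebra ℂ 𝔤 ⊗[ℂ] ℂ) ⧸ _))

instance : IsScalarTower ℂ (UniversalEnvelopingAlgebra ℂ 𝔤) (T.Verma μ) :=
  inferInstanceAs (IsScalarTower ℂ (UniversalEnvelopingAlgebra ℂ 𝔤)
    ((UniversalEnvelopingAlgebra ℂ 𝔤 ⊗[ℂ] ℂ) ⧸ _))

/-- The `𝔤`-action on `M(μ)` is the restriction of the `U(𝔤)`-action. -/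
instance : LieRingModule 𝔤 (T.Verma μ) where
  bracket x m := UniversalEnvelopingAlgebra.ι ℂ x • m
  add_lie x y m := by
    rw [map_add, add_smul]
  lie_add x m n := smul_add _ m n
  leibniz_lie x y m := by
    change UniversalEnvelopingAlgebra.ι ℂ x • UniversalEnvelopingAlgebra.ι ℂ y • m =
      UniversalEnvelopingAlgebra.ι ℂ ⁅x, y⁆ • m +
        UniversalEnvelopingAlgebra.ι ℂ y • UniversalEnvelopingAlgebra.ι ℂ x • m
    rw [LieHom.map_lie, LieRing.of_associative_ring_bracket, sub_smul, mul_smul, mul_smul,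
      sub_add_cancel]

theorem lie_def (x : 𝔤) (m : T.Verma μ) : ⁅x, m⁆ = UniversalEnvelopingAlgebra.ι ℂ x • m := rfl

instance : LieModule ℂ 𝔤 (T.Verma μ) where
  smul_lie c x m := by rw [lie_def, lie_def, map_smul, smul_assoc]
  lie_smul c x m := by rw [lie_def, lie_def, smul_algebra_smul_comm]

end Verma

/-! ### Completions -/

section Completion

variable (M : Type v) [AddCommGroup M] [Module ℂ M] [LieRingModule 𝔤 M] [LieModule ℂ 𝔤 M]

/-- The completion `∏_{ν ∈ 𝔥*} M_ν`. -/
def Completion : Type (max u v) := (ν : Module.Dual ℂ T.h) → T.weightSpace M ν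

namespace Completion

instance : AddCommGroup (T.Completion M) :=
  inferInstanceAs (AddCommGroup ((ν : Module.Dual ℂ T.h) → T.weightSpace M ν))

instance : Module ℂ (T.Completion M) :=
  inferInstanceAs (Module ℂ ((ν : Module.Dual ℂ T.h) → T.weightSpace M ν))

/-- The action of a root vector `x ∈ 𝔤_α` on the completion: `(x f)_ν = x f_{ν - α}`. -/
def rootAction (α : Module.Dual ℂ T.h) :
    T.weightSpace 𝔤 α →ₗ[ℂ] Module.End ℂ (T.Completion M) :=
  LinearMap.mk₂ ℂ
    (fun (x : T.weightSpace 𝔤 α) (f : T.Completion M) (ν : Module.Dual ℂ T.h) =>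
      (⟨⁅(x : 𝔤), (f (ν - α) : M)⁆, by
        simpa using T.lie_mem_weightSpace x.2 (f (ν - α)).2⟩ : T.weightSpace M ν))
    (fun x y f => funext fun ν => Subtype.ext (add_lie (x : 𝔤) (y : 𝔤) (f (ν - α) : M)))
    (fun c x f => funext fun ν => Subtype.ext (smul_lie c (x : 𝔤) (f (ν - α) : M)))
    (fun x f g => funext fun ν => Subtype.ext (lie_add (x : 𝔤) (f (ν - α) : M) (g (ν - α) : M)))
    (fun c x f => funext fun ν => Subtype.ext (lie_smul c (x : 𝔤) (f (ν - α) : M)))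

open scoped Classical in
/-- The action of `𝔤 = ⊕_α 𝔤_α` on the completion, `(x f)_ν = ∑_α x_α f_{ν - α}`. -/
def action : 𝔤 →ₗ[ℂ] Module.End ℂ (T.Completion M) :=
  DirectSum.toModule ℂ (Module.Dual ℂ T.h) (Module.End ℂ (T.Completion M)) (rootAction T M) ∘ₗ
    (T.rootDecomposition.symm : 𝔤 →ₗ[ℂ] _)

open scoped Classical in
theorem action_apply {α : Module.Dual ℂ T.h} {x : 𝔤} (hx : x ∈ T.weightSpace 𝔤 α)
    (f : T.Completion M) (ν : Module.Dual ℂ T.h) :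
    (action T M x f ν : M) = ⁅x, (f (ν - α) : M)⁆ := by
  have h1 : T.rootDecomposition.symm x =
      DirectSum.lof ℂ (Module.Dual ℂ T.h) (fun α => T.weightSpace 𝔤 α) α ⟨x, hx⟩ := by
    rw [LinearEquiv.symm_apply_eq]
    exact (DirectSum.coeLinearMap_lof (fun α => T.weightSpace 𝔤 α) α (⟨x, hx⟩)).symm
  have h2 : action T M x = rootAction T M α ⟨x, hx⟩ := by
    simp only [action, LinearMap.comp_apply, LinearEquiv.coe_coe, h1]
    exact DirectSum.toModule_lof (φ := rootAction T M) ℂ α (⟨x, hx⟩ : T.weightSpace 𝔤 α)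
  rw [h2]
  rfl

open scoped Classical in
theorem action_lie (x y : 𝔤) : action T M ⁅x, y⁆ = ⁅action T M x, action T M y⁆ := by
  have htop : ⨆ α, T.weightSpace 𝔤 α = ⊤ := T.isInternal_weightSpace.submodule_iSup_eq_top
  have hx : x ∈ ⨆ α, T.weightSpace 𝔤 α := htop ▸ Submodule.mem_top
  have hy : y ∈ ⨆ α, T.weightSpace 𝔤 α := htop ▸ Submodule.mem_top
  induction hx using Submodule.iSup_induction' with
  | zero => simp
  | add a b _ _ ha hb => simp [ha, hb]
  | mem α x hx =>
    induction hy using Submodule.iSup_induction' with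
    | zero => simp
    | add a b _ _ ha hb => simp [ha, hb]
    | mem β y hy =>
      refine LinearMap.ext fun f => funext fun ν => Subtype.ext ?_
      have e1 : ν - α - β = ν - (α + β) := by abel
      have e2 : ν - β - α = ν - (α + β) := by abel
      have h1 : (action T M x (action T M y f) ν : M) = ⁅x, ⁅y, (f (ν - (α + β)) : M)⁆⁆ := by
        rw [action_apply T M hx, action_apply T M hy, e1]
      have h2 : (action T M y (action T M x f) ν : M) = ⁅y, ⁅x, (f (ν - (α + β)) : M)⁆⁆ := by
        rw [action_apply T M hy, action_apply T M hx, e2]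
      have h3 : ((⁅action T M x, action T M y⁆ : Module.End ℂ (T.Completion M)) f ν : M) =
          (action T M x (action T M y f) ν : M) - (action T M y (action T M x f) ν : M) := rfl
      rw [action_apply T M (T.lie_mem_weightSpace hx hy), h3, h1, h2, lie_lie]

/-- The induced `𝔤`-module structure on the completion. -/
instance : LieRingModule 𝔤 (T.Completion M) where
  bracket x f := action T M x f
  add_lie x y f := by
    change action T M (x + y) f = _
    rw [map_add]
    rfl
  lie_add x f g := map_add (action T M x) f g
  leibniz_lie x y f := by
    change action T M x (action T M y f) = action T M ⁅x, y⁆ f + action T M y (action T M x f)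
    rw [action_lie]
    simp [LieRing.of_associative_ring_bracket]

instance : LieModule ℂ 𝔤 (T.Completion M) where
  smul_lie c x f := by
    change action T M (c • x) f = c • action T M x f
    rw [map_smul]
    rfl
  lie_smul c x f := map_smul (action T M x) c f

end Completion

end Completion

end TriangularDecomposition

/-- The `𝔫`-submodule `W_χ(M)` of Whittaker vectors of a `𝔤`-module `M` for a character `χ`
of a subalgebra `𝔫` of `𝔤`: the vectors `v` with `x v = χ(x) v` for all `x ∈ 𝔫`. -/
def whittakerVectors {𝔤 : Type u} [LieRing 𝔤] [LieAlgebra ℂ 𝔤] (𝔫 : LieSubalgebra ℂ 𝔤)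
    (χ : LieAlgebra.LieCharacter ℂ 𝔫) (M : Type v) [AddCommGroup M] [Module ℂ M]
    [LieRingModule 𝔤 M] [LieModule ℂ 𝔤 M] : LieSubmodule ℂ 𝔫 M where
  carrier := {v | ∀ x : 𝔫, ⁅(x : 𝔤), v⁆ = χ x • v}
  zero_mem' x := by simp
  add_mem' {v w} hv hw x := by rw [lie_add, hv x, hw x, smul_add]
  smul_mem' c v hv x := by rw [lie_smul, hv x, smul_comm]
  lie_mem {y v} hv x := by
    have h1 : ⁅y, v⁆ = χ y • v := hv y
    rw [h1, lie_smul, hv x, smul_comm]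

end

/-! Twist the dual `M(μ)*` by `σ`, so that `x` acts on functionals by precomposition with `σ x`. The
contravariant form identifies the completion of `M(μ)` with this full dual: it pairs distinct weight
spaces to zero, simplicity makes it nondegenerate, and the weight spaces are finite dimensional, so
a product over all weights is exactly what a functional amounts to (`completionPairing_injective`,
`completionPairing_surjective`). Whittaker vectors for `χ` become functionals `F` with `F (σ(x) m) =
χ(x) F(m)`, that is, `𝔫₋`-maps from `M(μ)` to a one-dimensional module (`mem_whittakerVectors_iff`).

Such an `F` is determined by its value at the highest weight vector, which generates `M(μ)` over
`𝔫₋` (`Verma.eq_top_of_nNeg_lie_mem`). For existence, `𝔤` acts on `U(𝔫₋)` as on the module induced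
from `𝔟` (`inducedRep`); the universal property gives `M(μ) → U(𝔫₋)` with generator going to `1`,
and the character of `𝔫₋` extends to an algebra map `U(𝔫₋) → ℂ`. No injectivity of `M(μ) → U(𝔫₋)` is
needed, so the PBW theorem is avoided.

The form has the same source: for the zero character, the functional so obtained is a highest weight
vector of weight `μ` in the twisted dual, so the universal property yields `M(μ) → M(μ)*`. -/

noncomputable section

/-! ### The induced module of `L = a ⊕ b`, realised on `U(a)`. -/

namespace UniversalEnvelopingAlgebra

variable {R : Type*} {L : Type*} [CommRing R] [LieRing L] [LieAlgebra R L]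

/-- A submodule of the enveloping algebra which contains `1` and is stable under left
multiplication by the Lie algebra is everything. -/
theorem mem_of_one_mem_of_mul_mem (S : Submodule R (UniversalEnvelopingAlgebra R L))
    (h1 : 1 ∈ S) (hmul : ∀ (x : L), ∀ u ∈ S, ι R x * u ∈ S) (u : UniversalEnvelopingAlgebra R L) :
    u ∈ S := by
  -- The left multipliers of `S` form a subalgebra containing `L`. The universal property maps
  -- `U(L)` into it, and followed by the inclusion this is the identity.
  let B : Subalgebra R (UniversalEnvelopingAlgebra R L) :=
    { carrier := {w | ∀ s ∈ S, w * s ∈ S}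
      mul_mem' := fun {a b} ha hb s hs => by
        rw [mul_assoc]
        exact ha _ (hb _ hs)
      add_mem' := fun {a b} ha hb s hs => by
        rw [add_mul]
        exact S.add_mem (ha _ hs) (hb _ hs)
      algebraMap_mem' := fun r s hs => by
        rw [← Algebra.smul_def]
        exact S.smul_mem r hs }
  let f : L →ₗ⁅R⁆ B :=
    { toFun := fun x => ⟨ι R x, fun s hs => hmul x s hs⟩
      map_add' := fun x y => Subtype.ext (map_add (ι R) x y)
      map_smul' := fun c x => Subtype.ext (map_smul (ι R) c x)
      map_lie' := fun {x y} => Subtype.ext (by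
        simp [LieRing.of_associative_ring_bracket]) }
  have hid : B.val.comp (lift R f) = AlgHom.id R _ := by
    refine hom_ext R (LieHom.ext fun x => ?_)
    change ((lift R f (ι R x) : B) : UniversalEnvelopingAlgebra R L) = ι R x
    rw [lift_ι_apply]
    rfl
  have hu : u = ((lift R f u : B) : UniversalEnvelopingAlgebra R L) :=
    (DFunLike.congr_fun hid u).symm
  have := (lift R f u).2 1 h1
  rwa [mul_one, ← hu] at this

theorem induction_left {motive : UniversalEnvelopingAlgebra R L → Prop}
    (one : motive 1) (add : ∀ u w, motive u → motive w → motive (u + w))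
    (smul : ∀ (c : R) u, motive u → motive (c • u))
    (mul : ∀ (x : L) u, motive u → motive (ι R x * u)) (u : UniversalEnvelopingAlgebra R L) :
    motive u :=
  mem_of_one_mem_of_mul_mem
    { carrier := {u | motive u}
      add_mem' := fun {u w} hu hw => add u w hu hw
      zero_mem' := by simpa using smul 0 1 one
      smul_mem' := fun c u hu => smul c u hu } one mul u

variable {a : LieSubalgebra R L}

/-- The action of a subalgebra `a` of `L` on the linear maps `L → U(a)` which is given by left
multiplication on `U(a)` and by the adjoint action on `L`. -/
def homAction (a : LieSubalgebra R L) :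
    a →ₗ⁅R⁆ Module.End R (L →ₗ[R] UniversalEnvelopingAlgebra R a) where
  toFun x :=
    { toFun := fun φ => LinearMap.mulLeft R (ι R x) ∘ₗ φ - φ ∘ₗ LieModule.toEnd R L L (x : L)
      map_add' := fun φ ψ => LinearMap.ext fun y => by
        simp [mul_add]
        abel
      map_smul' := fun c φ => LinearMap.ext fun y => by
        simp [smul_sub] }
  map_add' x y := LinearMap.ext fun φ => LinearMap.ext fun z => by
    simp [add_mul]
    abel
  map_smul' c x := LinearMap.ext fun φ => LinearMap.ext fun z => by
    simp [smul_sub]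
  map_lie' {x y} := LinearMap.ext fun φ => LinearMap.ext fun z => by
    simp [LieRing.of_associative_ring_bracket, sub_mul, mul_sub, mul_assoc]
    abel

theorem homAction_apply (x : a) (φ : L →ₗ[R] UniversalEnvelopingAlgebra R a) (y : L) :
    homAction a x φ y = ι R x * φ y + φ ⁅y, (x : L)⁆ := by
  rw [← lie_skew y (x : L), map_neg, ← sub_eq_add_neg]
  rfl

variable (φ₁ : L →ₗ[R] UniversalEnvelopingAlgebra R a)

/-- The linear maps `U(a) → U(a)`, indexed by `y : L`, which take `1` to `φ₁ y` and satisfy the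
commutation relations with left multiplications that an action of `L` would satisfy. -/
def inducedMap : L →ₗ[R] Module.End R (UniversalEnvelopingAlgebra R a) :=
  -- The value at `u` and `y` is `(u • φ₁) y`. Recursion on `u` becomes a `U(a)`-action, so
  -- well-definedness needs no basis of `U(a)`.
  (LinearMap.applyₗ φ₁ ∘ₗ (lift R (homAction a)).toLinearMap).flip

theorem inducedMap_one (y : L) : inducedMap φ₁ y 1 = φ₁ y := by
  simp [inducedMap]

theorem inducedMap_mul (y : L) (x : a) (u : UniversalEnvelopingAlgebra R a) :
    inducedMap φ₁ y (ι R x * u) = ι R x * inducedMap φ₁ y u + inducedMap φ₁ ⁅y, (x : L)⁆ u := by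
  change lift R (homAction a) (ι R x * u) φ₁ y = ι R x * lift R (homAction a) u φ₁ y +
    lift R (homAction a) u φ₁ ⁅y, (x : L)⁆
  rw [map_mul, lift_ι_apply, Module.End.mul_apply, homAction_apply]

/-- On `y ∈ a`, left multiplication obeys the same recursion and the same initial value. The
inductive step also uses the claim for a bracket, hence the generalisation over `x`. -/
theorem inducedMap_coe (h : ∀ x : a, φ₁ x = ι R x) (x : a) (u : UniversalEnvelopingAlgebra R a) :
    inducedMap φ₁ x u = ι R x * u := by
  induction u using induction_left generalizing x with
  | one => rw [inducedMap_one, h, mul_one]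
  | add u w hu hw => rw [map_add, hu, hw, mul_add]
  | smul c u hu => rw [map_smul, hu, mul_smul_comm]
  | mul y u hu =>
    have := hu ⁅x, y⁆
    rw [LieSubalgebra.coe_bracket] at this
    rw [inducedMap_mul, this, hu, LieHom.map_lie, LieRing.of_associative_ring_bracket]
    simp only [sub_mul, mul_assoc]
    abel

/-- The relations of `L` hold on `U(a)` as soon as they hold on `1`. -/
theorem inducedMap_lie
    (h : ∀ y z : L, inducedMap φ₁ y (φ₁ z) - inducedMap φ₁ z (φ₁ y) = φ₁ ⁅y, z⁆)
    (y z : L) (u : UniversalEnvelopingAlgebra R a) :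
    inducedMap φ₁ y (inducedMap φ₁ z u) - inducedMap φ₁ z (inducedMap φ₁ y u) =
      inducedMap φ₁ ⁅y, z⁆ u := by
  induction u using induction_left generalizing y z with
  | one => simpa only [inducedMap_one] using h y z
  | add u w hu hw =>
    simp only [map_add, ← hu, ← hw]
    abel
  | smul c u hu => simp only [map_smul, ← hu, smul_sub]
  | mul x u hu =>
    -- Moving `x` to the left past both operators leaves the relations for `([y,x], z)` and `(y,
    -- [z,x])` at `u`; the Jacobi identity `h3` matches their sum with the right-hand side.
    have h1 := hu ⁅y, (x : L)⁆ z
    have h2 := hu y ⁅z, (x : L)⁆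
    have h3 : ⁅⁅y, z⁆, (x : L)⁆ = ⁅⁅y, (x : L)⁆, z⁆ + ⁅y, ⁅z, (x : L)⁆⁆ := by
      rw [lie_lie y z, ← lie_skew z ⁅y, (x : L)⁆]
      abel
    simp only [inducedMap_mul, map_add, h3, LinearMap.add_apply, ← h1, ← h2, ← hu y z, mul_sub]
    abel

section actionOnOne

variable {b : LieSubalgebra R L} (p : L →ₗ[R] a) (q : L →ₗ[R] b) (μ : LieAlgebra.LieCharacter R b)

/-- The map `L = a ⊕ b → U(a)` which is the inclusion on `a` and `μ` on `b`. -/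
def actionOnOne : L →ₗ[R] UniversalEnvelopingAlgebra R a :=
  (ι R : a →ₗ⁅R⁆ UniversalEnvelopingAlgebra R a).toLinearMap ∘ₗ p +
    (LieHom.toLinearMap μ ∘ₗ q).smulRight 1

theorem actionOnOne_apply (x : L) :
    actionOnOne p q μ x = ι R (p x) + μ (q x) • (1 : UniversalEnvelopingAlgebra R a) := rfl

theorem actionOnOne_left (hpa : ∀ x : a, p x = x) (hqa : ∀ x : a, q x = 0) (x : a) :
    actionOnOne p q μ x = ι R x := by
  rw [actionOnOne_apply, hpa, hqa, map_zero, zero_smul, add_zero]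

theorem actionOnOne_right (hpb : ∀ x : b, p x = 0) (hqb : ∀ x : b, q x = x) (x : b) :
    actionOnOne p q μ x = μ x • (1 : UniversalEnvelopingAlgebra R a) := by
  rw [actionOnOne_apply, hpb, hqb, map_zero, zero_add]

end actionOnOne

/-- If `L = a ⊕ b` for subalgebras `a` and `b`, with projections `p` and `q`, then `L` acts on
`U(a)`, which becomes the module induced from a character `μ` of `b`. -/
def inducedRep {a b : LieSubalgebra R L} (p : L →ₗ[R] a) (q : L →ₗ[R] b)
    (hpq : ∀ x, (p x : L) + q x = x) (hpa : ∀ x : a, p x = x) (hqa : ∀ x : a, q x = 0)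
    (hpb : ∀ x : b, p x = 0) (hqb : ∀ x : b, q x = x) (μ : LieAlgebra.LieCharacter R b) :
    L →ₗ⁅R⁆ Module.End R (UniversalEnvelopingAlgebra R a) :=
  let φ₁ := actionOnOne p q μ
  have hφa := actionOnOne_left p q μ hpa hqa
  have hφb := actionOnOne_right p q μ hpb hqb
  { inducedMap φ₁ with
    map_lie' := fun {y z} => by
      -- The relation on `1` is bilinear, so it is checked by blocks. With one argument in `a` it is
      -- the commutation rule; on `b × b` both sides vanish, because `μ` kills brackets and takes
      -- commuting values.
      have hl : ∀ (x : a) (z : L), inducedMap φ₁ x (φ₁ z) - inducedMap φ₁ z (φ₁ x) =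
          φ₁ ⁅(x : L), z⁆ := fun x z => by
        rw [inducedMap_coe φ₁ hφa, hφa, ← mul_one (ι R x), inducedMap_mul, inducedMap_one,
          inducedMap_one, mul_one, ← lie_skew, map_neg]
        abel
      have hr : ∀ (x : a) (z : L), inducedMap φ₁ z (φ₁ x) - inducedMap φ₁ x (φ₁ z) =
          φ₁ ⁅z, (x : L)⁆ := fun x z => by
        rw [← lie_skew, map_neg, ← hl, neg_sub]
      have hb : ∀ x y : b, inducedMap φ₁ x (φ₁ y) - inducedMap φ₁ y (φ₁ x) =
          φ₁ ⁅(x : L), (y : L)⁆ := fun x y => by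
        have h0 : μ ⁅x, y⁆ = 0 := LieAlgebra.lieCharacter_apply_lie μ x y
        have := hφb ⁅x, y⁆
        rw [LieSubalgebra.coe_bracket, h0] at this
        rw [this, hφb, hφb, map_smul, map_smul, inducedMap_one, inducedMap_one, hφb, hφb,
          smul_smul, smul_smul, mul_comm, zero_smul, sub_self]
      have key := inducedMap_lie φ₁ (fun y z => by
        rw [← hpq y, ← hpq z]
        have e1 := hl (p y) (p z)
        have e2 := hl (p y) (q z)
        have e3 := hr (p z) (q y)
        have e4 := hb (q y) (q z)
        simp only [map_add, LinearMap.add_apply, add_lie, lie_add, ← e1, ← e2, ← e3, ← e4]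
        abel) y z
      refine LinearMap.ext fun u => ?_
      exact (key u).symm }

section inducedRep

variable {a b : LieSubalgebra R L} (p : L →ₗ[R] a) (q : L →ₗ[R] b)
    (hpq : ∀ x, (p x : L) + q x = x) (hpa : ∀ x : a, p x = x) (hqa : ∀ x : a, q x = 0)
    (hpb : ∀ x : b, p x = 0) (hqb : ∀ x : b, q x = x) (μ : LieAlgebra.LieCharacter R b)

theorem inducedRep_left (x : a) (u : UniversalEnvelopingAlgebra R a) :
    inducedRep p q hpq hpa hqa hpb hqb μ x u = ι R x * u :=
  inducedMap_coe _ (actionOnOne_left p q μ hpa hqa) x u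

theorem inducedRep_right (x : b) :
    inducedRep p q hpq hpa hqa hpb hqb μ x 1 = μ x • 1 :=
  (inducedMap_one _ _).trans (actionOnOne_right p q μ hpb hqb x)

end inducedRep

end UniversalEnvelopingAlgebra

/-! ### The universal property of Verma modules and the functionals from characters of `𝔫₋`. -/

namespace TriangularDecomposition

variable {𝔤 : Type u} [LieRing 𝔤] [LieAlgebra ℂ 𝔤] (T : TriangularDecomposition 𝔤)

theorem isCompl_nNeg_borel : IsCompl T.nNeg.toSubmodule T.borel.toSubmodule := by
  have h := T.isInternal.submodule_iSupIndep 0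
  refine ⟨h.mono_right (sup_le ?_ ?_), ?_⟩
  · exact le_iSup₂_of_le (1 : Fin 3) (by decide) le_rfl
  · exact le_iSup₂_of_le (2 : Fin 3) (by decide) le_rfl
  · rw [codisjoint_iff]
    exact T.iSup_triple

theorem nPos_le_borel {x : 𝔤} (hx : x ∈ T.nPos) : x ∈ T.borel :=
  (le_sup_right : T.nPos.toSubmodule ≤ T.h.toSubmodule ⊔ T.nPos.toSubmodule) hx

theorem h_le_borel {x : 𝔤} (hx : x ∈ T.h) : x ∈ T.borel :=
  (le_sup_left : T.h.toSubmodule ≤ T.h.toSubmodule ⊔ T.nPos.toSubmodule) hx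

variable (μ : Module.Dual ℂ T.h)

theorem borelCharacter_apply (x : T.borel) : T.borelCharacter μ x = μ (T.projH x) := rfl

theorem projH_coe (x : T.h) : T.projH x = x :=
  Submodule.projectionOnto_apply_left T.isCompl_h x

theorem exists_add_of_mem_borel {x : 𝔤} (hx : x ∈ T.borel) :
    ∃ y ∈ T.h, ∃ z ∈ T.nPos, x = y + z := by
  obtain ⟨y, hy, z, hz, rfl⟩ := Submodule.mem_sup.mp hx
  exact ⟨y, hy, z, hz, rfl⟩

theorem exists_add_borel (x : 𝔤) : ∃ y ∈ T.nNeg, ∃ z ∈ T.borel, x = y + z := by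
  have hx : x ∈ T.nNeg.toSubmodule ⊔ T.borel.toSubmodule := by
    rw [T.isCompl_nNeg_borel.sup_eq_top]
    exact Submodule.mem_top
  obtain ⟨y, hy, z, hz, rfl⟩ := Submodule.mem_sup.mp hx
  exact ⟨y, hy, z, hz, rfl⟩

/-- The action of `𝔤` on `U(𝔫₋)`, identified with the Verma module of highest weight `μ`. -/
def nNegRep : 𝔤 →ₗ⁅ℂ⁆ Module.End ℂ (UniversalEnvelopingAlgebra ℂ T.nNeg) :=
  UniversalEnvelopingAlgebra.inducedRep (a := T.nNeg) (b := T.borel)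
    (Submodule.projectionOnto _ _ T.isCompl_nNeg_borel)
    (Submodule.projectionOnto _ _ T.isCompl_nNeg_borel.symm)
    (fun x => Submodule.projection_add_projection_eq_self T.isCompl_nNeg_borel x)
    (Submodule.projectionOnto_apply_left _)
    (Submodule.projectionOnto_apply_right _)
    (Submodule.projectionOnto_apply_right _)
    (Submodule.projectionOnto_apply_left _)
    (T.borelCharacter μ)

theorem nNegRep_nNeg (x : T.nNeg) (u : UniversalEnvelopingAlgebra ℂ T.nNeg) :
    T.nNegRep μ x u = UniversalEnvelopingAlgebra.ι ℂ x * u :=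
  UniversalEnvelopingAlgebra.inducedRep_left ..

theorem nNegRep_borel (x : T.borel) : T.nNegRep μ x 1 = T.borelCharacter μ x • 1 :=
  UniversalEnvelopingAlgebra.inducedRep_right ..

namespace Verma

/-- The canonical generator `1 ⊗ 1` of the Verma module. -/
def highestWeightVector : T.Verma μ :=
  (Submodule.Quotient.mk ((1 : UniversalEnvelopingAlgebra ℂ 𝔤) ⊗ₜ[ℂ] (1 : ℂ)) :
    (UniversalEnvelopingAlgebra ℂ 𝔤 ⊗[ℂ] ℂ) ⧸ _)

theorem borel_lie_highestWeightVector (x : T.borel) :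
    ⁅(x : 𝔤), highestWeightVector T μ⁆ = T.borelCharacter μ x • highestWeightVector T μ := by
  refine (Submodule.Quotient.eq _).mpr (Submodule.subset_span
    ⟨1, UniversalEnvelopingAlgebra.ι ℂ x, 1, ?_⟩)
  have h1 : T.borelInclusion (UniversalEnvelopingAlgebra.ι ℂ x) =
      UniversalEnvelopingAlgebra.ι ℂ (x : 𝔤) :=
    UniversalEnvelopingAlgebra.lift_ι_apply ℂ _ x
  have h2 : T.borelAction μ (UniversalEnvelopingAlgebra.ι ℂ x) = T.borelCharacter μ x :=
    UniversalEnvelopingAlgebra.lift_ι_apply ℂ _ x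
  beta_reduce
  rw [h1, h2, one_mul, mul_one, TensorProduct.smul_tmul', TensorProduct.smul_tmul',
    TensorProduct.smul_tmul (T.borelCharacter μ x), smul_eq_mul, smul_eq_mul, mul_one, mul_one]

variable {μ} {N : Type v} [AddCommGroup N] [Module ℂ N] (ρ : 𝔤 →ₗ⁅ℂ⁆ Module.End ℂ N) (n : N)

/-- The map `U(𝔤) ⊗ ℂ → N`, `w ⊗ z ↦ z w n`. -/
def preLift : (UniversalEnvelopingAlgebra ℂ 𝔤 ⊗[ℂ] ℂ) →ₗ[ℂ] N :=
  LinearMap.applyₗ n ∘ₗ (UniversalEnvelopingAlgebra.lift ℂ ρ).toLinearMap ∘ₗ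
    (TensorProduct.rid ℂ _).toLinearMap

theorem preLift_tmul (w : UniversalEnvelopingAlgebra ℂ 𝔤) (z : ℂ) :
    preLift ρ n (w ⊗ₜ z) = z • UniversalEnvelopingAlgebra.lift ℂ ρ w n := by
  simp [preLift]

/-- Equivariance reduces vanishing on the `U(𝔤)`-span of the tensor relations to vanishing on the
relations themselves. -/
theorem preLift_smul (w : UniversalEnvelopingAlgebra ℂ 𝔤)
    (t : UniversalEnvelopingAlgebra ℂ 𝔤 ⊗[ℂ] ℂ) :
    preLift ρ n (w • t) = UniversalEnvelopingAlgebra.lift ℂ ρ w (preLift ρ n t) := by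
  induction t using TensorProduct.induction_on with
  | zero => simp
  | add a b ha hb => rw [smul_add, map_add, ha, hb, map_add, map_add]
  | tmul u z =>
    rw [TensorProduct.smul_tmul', preLift_tmul, preLift_tmul, smul_eq_mul, map_mul, map_smul]
    rfl

theorem lift_borelInclusion
    (hn : ∀ x : T.borel, ρ x n = T.borelCharacter μ x • n)
    (b : UniversalEnvelopingAlgebra ℂ T.borel) :
    UniversalEnvelopingAlgebra.lift ℂ ρ (T.borelInclusion b) n = T.borelAction μ b • n := by
  induction b using UniversalEnvelopingAlgebra.induction_left with
  | one => simp
  | add u w hu hw => rw [map_add, map_add, LinearMap.add_apply, hu, hw, map_add, add_smul]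
  | smul c u hu => rw [map_smul, map_smul, LinearMap.smul_apply, hu, map_smul, smul_assoc]
  | mul x u hu =>
    have h1 : T.borelInclusion (UniversalEnvelopingAlgebra.ι ℂ x) =
        UniversalEnvelopingAlgebra.ι ℂ (x : 𝔤) :=
      UniversalEnvelopingAlgebra.lift_ι_apply ℂ _ x
    have h2 : T.borelAction μ (UniversalEnvelopingAlgebra.ι ℂ x) = T.borelCharacter μ x :=
      UniversalEnvelopingAlgebra.lift_ι_apply ℂ _ x
    rw [map_mul, map_mul, Module.End.mul_apply, hu, map_smul, h1,
      UniversalEnvelopingAlgebra.lift_ι_apply, hn, map_mul, h2, smul_smul, mul_comm]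

theorem preLift_eq_zero (hn : ∀ x : T.borel, ρ x n = T.borelCharacter μ x • n)
    {t : UniversalEnvelopingAlgebra ℂ 𝔤 ⊗[ℂ] ℂ}
    (ht : t ∈ Submodule.span (UniversalEnvelopingAlgebra ℂ 𝔤)
      {t : UniversalEnvelopingAlgebra ℂ 𝔤 ⊗[ℂ] ℂ |
        ∃ (w : UniversalEnvelopingAlgebra ℂ 𝔤) (b : UniversalEnvelopingAlgebra ℂ T.borel) (z : ℂ),
          t = (w * T.borelInclusion b) ⊗ₜ[ℂ] z - w ⊗ₜ[ℂ] (T.borelAction μ b * z)}) :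
    preLift ρ n t = 0 := by
  induction ht using Submodule.span_induction with
  | zero => exact map_zero _
  | add a b _ _ ha hb => rw [map_add, ha, hb, add_zero]
  | smul w t _ ht => rw [preLift_smul, ht, map_zero]
  | mem t ht =>
    obtain ⟨w, b, z, rfl⟩ := ht
    rw [map_sub, preLift_tmul, preLift_tmul, map_mul, Module.End.mul_apply,
      lift_borelInclusion T ρ n hn, map_smul, smul_smul, mul_comm z, sub_self]

variable (hn : ∀ x : T.borel, ρ x n = T.borelCharacter μ x • n)

/-- The universal property of the Verma module. -/
def lift : T.Verma μ →ₗ[ℂ] N where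
  __ := QuotientAddGroup.lift _ (preLift ρ n).toAddMonoidHom
    fun _ ht => preLift_eq_zero T ρ n hn ht
  map_smul' c m := by
    obtain ⟨t, rfl⟩ := Submodule.Quotient.mk_surjective _ m
    exact map_smul (preLift ρ n) c t

theorem lift_highestWeightVector : lift T ρ n hn (highestWeightVector T μ) = n := by
  change preLift ρ n (1 ⊗ₜ 1) = n
  simp [preLift_tmul]

theorem lift_lie (x : 𝔤) (m : T.Verma μ) : lift T ρ n hn ⁅x, m⁆ = ρ x (lift T ρ n hn m) := by
  obtain ⟨t, rfl⟩ := Submodule.Quotient.mk_surjective _ m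
  change preLift ρ n (UniversalEnvelopingAlgebra.ι ℂ x • t) = ρ x (preLift ρ n t)
  rw [preLift_smul, UniversalEnvelopingAlgebra.lift_ι_apply]

end Verma

/-- A character of `𝔫₋` defines a linear functional on the Verma module. -/
def whittakerFunctional (χ : LieAlgebra.LieCharacter ℂ T.nNeg) : Module.Dual ℂ (T.Verma μ) :=
  (UniversalEnvelopingAlgebra.lift ℂ χ).toLinearMap ∘ₗ
    Verma.lift T (T.nNegRep μ) 1 (T.nNegRep_borel μ)

theorem whittakerFunctional_highestWeightVector (χ : LieAlgebra.LieCharacter ℂ T.nNeg) :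
    T.whittakerFunctional μ χ (Verma.highestWeightVector T μ) = 1 := by
  simp [whittakerFunctional, Verma.lift_highestWeightVector]

/-- `𝔫₋` acts on `U(𝔫₋)` by left multiplication, and the extension of `χ` to `U(𝔫₋)` is
multiplicative. -/
theorem whittakerFunctional_lie (χ : LieAlgebra.LieCharacter ℂ T.nNeg) (x : T.nNeg)
    (m : T.Verma μ) : T.whittakerFunctional μ χ ⁅(x : 𝔤), m⁆ =
      χ x * T.whittakerFunctional μ χ m := by
  change UniversalEnvelopingAlgebra.lift ℂ χ (Verma.lift T (T.nNegRep μ) 1 _ ⁅(x : 𝔤), m⁆) = _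
  rw [Verma.lift_lie, nNegRep_nNeg, map_mul, UniversalEnvelopingAlgebra.lift_ι_apply]
  rfl

end TriangularDecomposition

/-! ### The twisted dual and the contravariant form. -/

namespace TriangularDecomposition

variable {𝔤 : Type u} [LieRing 𝔤] [LieAlgebra ℂ 𝔤] (T : TriangularDecomposition 𝔤)

theorem σ_mem_nNeg {x : 𝔤} (hx : x ∈ T.nPos) : T.σ x ∈ T.nNeg := by
  change T.σ x ∈ T.nNeg.toSubmodule
  rw [← T.σ_nPos]
  exact Submodule.mem_map_of_mem hx

theorem exists_σ_eq_of_mem_nNeg {x : 𝔤} (hx : x ∈ T.nNeg) : ∃ y ∈ T.nPos, T.σ y = x := by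
  change x ∈ T.nNeg.toSubmodule at hx
  rw [← T.σ_nPos] at hx
  obtain ⟨y, hy, rfl⟩ := hx
  exact ⟨y, hy, rfl⟩

theorem σ_mem_nPos {x : 𝔤} (hx : x ∈ T.nNeg) : T.σ x ∈ T.nPos := by
  obtain ⟨y, hy, rfl⟩ := T.exists_σ_eq_of_mem_nNeg hx
  rwa [T.σ_σ]

theorem h_lie_nNeg {x y : 𝔤} (hx : x ∈ T.h) (hy : y ∈ T.nNeg) : ⁅x, y⁆ ∈ T.nNeg := by
  have h1 : ⁅x, y⁆ = -T.σ ⁅x, T.σ y⁆ := by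
    rw [T.σ_lie, T.σ_σ, T.σ_h x hx, lie_skew]
  rw [h1]
  exact T.nNeg.neg_mem (T.σ_mem_nNeg (T.h_lie_nPos hx (T.σ_mem_nPos hy)))

/-- The `𝔤`-action on the dual space of a `𝔤`-module which is twisted by the anti-involution. -/
def dualRep (M : Type v) [AddCommGroup M] [Module ℂ M] [LieRingModule 𝔤 M] [LieModule ℂ 𝔤 M] :
    𝔤 →ₗ⁅ℂ⁆ Module.End ℂ (Module.Dual ℂ M) where
  toFun x := LinearMap.lcomp ℂ ℂ (LieModule.toEnd ℂ 𝔤 M (T.σ x))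
  map_add' x y := LinearMap.ext fun F => LinearMap.ext fun m => by simp
  map_smul' c x := LinearMap.ext fun F => LinearMap.ext fun m => by simp
  -- Precomposition and `σ` each reverse the order of products; the two reversals cancel.
  map_lie' {x y} := LinearMap.ext fun F => LinearMap.ext fun m => by
    simp [LieRing.of_associative_ring_bracket, T.σ_lie]

@[simp]
theorem dualRep_apply {M : Type v} [AddCommGroup M] [Module ℂ M] [LieRingModule 𝔤 M]
    [LieModule ℂ 𝔤 M] (x : 𝔤) (F : Module.Dual ℂ M) (m : M) :
    T.dualRep M x F m = F ⁅T.σ x, m⁆ := rfl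

/-- A nonzero subspace of an irreducible module which is stable under the action is everything. -/
theorem eq_top_of_lie_mem {M : Type v} [AddCommGroup M] [Module ℂ M]
    [LieRingModule 𝔤 M] [LieModule ℂ 𝔤 M] [LieModule.IsIrreducible ℂ 𝔤 M] (S : Submodule ℂ M)
    (hS : ∀ x : 𝔤, ∀ m ∈ S, ⁅x, m⁆ ∈ S) {v : M} (hv : v ∈ S) (hv0 : v ≠ 0) : S = ⊤ := by
  let N : LieSubmodule ℂ 𝔤 M := { S with lie_mem := fun {x m} hm => hS x m hm }
  have hN : N = ⊤ := (eq_bot_or_eq_top N).resolve_left fun h => hv0 <| by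
    have : v ∈ N := hv
    rwa [h, LieSubmodule.mem_bot] at this
  exact (LieSubmodule.toSubmodule_eq_top (N := N)).mpr hN

theorem iSupIndep_weightSpace (M : Type v) [AddCommGroup M] [Module ℂ M]
    [LieRingModule 𝔤 M] [LieModule ℂ 𝔤 M] : iSupIndep fun ν => T.weightSpace M ν := by
  have h1 := LieSubmodule.iSupIndep_toSubmodule.mpr (LieModule.iSupIndep_genWeightSpace ℂ T.h M)
  have h2 := h1.comp (f := fun α : Module.Dual ℂ T.h => (α : T.h → ℂ)) DFunLike.coe_injective
  exact h2.mono fun α => LieModule.weightSpace_le_genWeightSpace M (α : T.h → ℂ)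

theorem lie_mem_iSup_weightSpace {M : Type v} [AddCommGroup M] [Module ℂ M]
    [LieRingModule 𝔤 M] [LieModule ℂ 𝔤 M] (x : 𝔤) {m : M} (hm : m ∈ ⨆ ν, T.weightSpace M ν) :
    ⁅x, m⁆ ∈ ⨆ ν, T.weightSpace M ν := by
  classical
  have hx : x ∈ ⨆ α, T.weightSpace 𝔤 α :=
    T.isInternal_weightSpace.submodule_iSup_eq_top ▸ Submodule.mem_top
  induction hx using Submodule.iSup_induction' with
  | zero => simp
  | add a b _ _ ha hb =>
    rw [add_lie]
    exact add_mem ha hb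
  | mem α x hx =>
    induction hm using Submodule.iSup_induction' with
    | zero => simp
    | add a b _ _ ha hb =>
      rw [lie_add]
      exact add_mem ha hb
    | mem ν m hm => exact Submodule.mem_iSup_of_mem _ (T.lie_mem_weightSpace hx hm)

variable (μ : Module.Dual ℂ T.h)

namespace Verma

theorem highestWeightVector_mem : highestWeightVector T μ ∈ T.weightSpace (T.Verma μ) μ := by
  rw [mem_weightSpace]
  intro x
  have := borel_lie_highestWeightVector T μ ⟨x, T.h_le_borel x.2⟩
  rwa [borelCharacter_apply, T.projH_coe] at this

theorem highestWeightVector_ne_zero : highestWeightVector T μ ≠ 0 := by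
  intro h
  have := T.whittakerFunctional_highestWeightVector μ 0
  rw [h, map_zero] at this
  exact zero_ne_one this

variable {μ} [LieModule.IsIrreducible ℂ 𝔤 (T.Verma μ)]

/-- A simple Verma module is generated by its highest weight vector as an `𝔫₋`-module. -/
theorem eq_top_of_nNeg_lie_mem (S : Submodule ℂ (T.Verma μ)) (hv : highestWeightVector T μ ∈ S)
    (hS : ∀ x ∈ T.nNeg, ∀ m ∈ S, ⁅x, m⁆ ∈ S) : S = ⊤ := by
  -- `sInf C` is the smallest `𝔫₋`-stable subspace containing the generator. It remains to see that
  -- it is also `𝔟`-stable, since simplicity then makes it everything.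
  let C : Set (Submodule ℂ (T.Verma μ)) :=
    {S | highestWeightVector T μ ∈ S ∧ ∀ x ∈ T.nNeg, ∀ m ∈ S, ⁅x, m⁆ ∈ S}
  have hC1 : highestWeightVector T μ ∈ sInf C := Submodule.mem_sInf.mpr fun S hS => hS.1
  have hC2 : ∀ x ∈ T.nNeg, ∀ m ∈ sInf C, ⁅x, m⁆ ∈ sInf C := fun x hx m hm =>
    Submodule.mem_sInf.mpr fun S hS => hS.2 x hx m (Submodule.mem_sInf.mp hm S hS)
  -- The vectors of `sInf C` that `𝔟` keeps inside `sInf C`. Once `S'` lies in `C`, minimality gives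
  -- `sInf C ≤ S'`, which is `𝔟`-stability.
  let S' : Submodule ℂ (T.Verma μ) :=
    { carrier := {m | m ∈ sInf C ∧ ∀ y ∈ T.borel, ⁅y, m⁆ ∈ sInf C}
      add_mem' := fun {a b} ha hb => ⟨add_mem ha.1 hb.1, fun y hy => by
        rw [lie_add]
        exact add_mem (ha.2 y hy) (hb.2 y hy)⟩
      zero_mem' := ⟨zero_mem _, fun y _ => by simp⟩
      smul_mem' := fun c m hm => ⟨Submodule.smul_mem _ c hm.1, fun y hy => by
        rw [lie_smul]
        exact Submodule.smul_mem _ c (hm.2 y hy)⟩ }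
  have hS' : S' ∈ C := by
    refine ⟨⟨hC1, fun y hy => ?_⟩, fun x hx m hm => ⟨hC2 x hx m hm.1, fun y hy => ?_⟩⟩
    · rw [borel_lie_highestWeightVector T μ ⟨y, hy⟩]
      exact Submodule.smul_mem _ _ hC1
    · rw [leibniz_lie]
      -- The bracket of `𝔟` with `𝔫₋` need not stay in either, so it is split into its two
      -- components.
      obtain ⟨a, ha, b, hb, hab⟩ := T.exists_add_borel ⁅y, x⁆
      rw [hab, add_lie]
      exact add_mem (add_mem (hC2 a ha m hm.1) (hm.2 b hb)) (hC2 x hx _ (hm.2 y hy))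
  have htop : sInf C = ⊤ := by
    refine eq_top_of_lie_mem (𝔤 := 𝔤) _ (fun x m hm => ?_) hC1 (highestWeightVector_ne_zero T μ)
    obtain ⟨a, ha, b, hb, rfl⟩ := T.exists_add_borel x
    rw [add_lie]
    exact add_mem (hC2 a ha m hm) ((sInf_le hS' hm).2 b hb)
  exact top_le_iff.mp (htop ▸ sInf_le (show S ∈ C from ⟨hv, hS⟩))

theorem iSup_weightSpace : ⨆ ν, T.weightSpace (T.Verma μ) ν = ⊤ :=
  eq_top_of_lie_mem (𝔤 := 𝔤) _ (fun x _ hm => T.lie_mem_iSup_weightSpace x hm)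
    (Submodule.mem_iSup_of_mem μ (highestWeightVector_mem T μ)) (highestWeightVector_ne_zero T μ)

/-- The identity holds at the generator. It holds on `𝔫₋ M(μ)` because the functional vanishes there
and `𝔥` normalises `𝔫₋`. -/
theorem whittakerFunctional_zero_h_lie (x : T.h) (m : T.Verma μ) :
    T.whittakerFunctional μ 0 ⁅(x : 𝔤), m⁆ = μ x * T.whittakerFunctional μ 0 m := by
  have key : ∀ y ∈ T.nNeg, ∀ m, T.whittakerFunctional μ 0 ⁅y, m⁆ = 0 := fun y hy m =>
    (T.whittakerFunctional_lie μ 0 ⟨y, hy⟩ m).trans (zero_mul _)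
  let S : Submodule ℂ (T.Verma μ) := LinearMap.eqLocus
    (T.whittakerFunctional μ 0 ∘ₗ LieModule.toEnd ℂ 𝔤 (T.Verma μ) (x : 𝔤))
    (μ x • T.whittakerFunctional μ 0)
  have hS : S = ⊤ := by
    refine eq_top_of_nNeg_lie_mem T S ?_ fun y hy m _ => ?_
    · change T.whittakerFunctional μ 0 ⁅(x : 𝔤), _⁆ = μ x * T.whittakerFunctional μ 0 _
      rw [(T.mem_weightSpace.mp (highestWeightVector_mem T μ)) x, map_smul, smul_eq_mul]
    · change T.whittakerFunctional μ 0 ⁅(x : 𝔤), ⁅y, m⁆⁆ = μ x * T.whittakerFunctional μ 0 ⁅y, m⁆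
      rw [leibniz_lie, map_add, key y hy, key y hy, key _ (T.h_lie_nNeg x.2 hy), mul_zero,
        add_zero]
  have : m ∈ S := hS ▸ Submodule.mem_top
  exact this

/-- `σ` fixes `𝔥` and carries `𝔫₊` into `𝔫₋`, whose image the functional kills. This is the
hypothesis under which the universal property produces the form. -/
theorem dualRep_whittakerFunctional_zero (x : T.borel) :
    T.dualRep (T.Verma μ) x (T.whittakerFunctional μ 0) =
      T.borelCharacter μ x • T.whittakerFunctional μ 0 := by
  refine LinearMap.ext fun m => ?_
  obtain ⟨y, hy, z, hz, h⟩ := T.exists_add_of_mem_borel x.2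
  have h1 : T.whittakerFunctional μ 0 ⁅T.σ z, m⁆ = 0 :=
    (T.whittakerFunctional_lie μ 0 ⟨_, T.σ_mem_nNeg hz⟩ m).trans (zero_mul _)
  have h2 := T.projH_coe ⟨y, hy⟩
  simp only at h2
  rw [borelCharacter_apply, dualRep_apply, h, map_add, add_lie, map_add, h1, T.σ_h y hy, map_add,
    T.projH_nPos hz, h2, whittakerFunctional_zero_h_lie T ⟨y, hy⟩]
  simp

/-- The contravariant form on a simple Verma module. -/
def contravariantForm : T.Verma μ →ₗ[ℂ] Module.Dual ℂ (T.Verma μ) :=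
  Verma.lift T (T.dualRep (T.Verma μ)) (T.whittakerFunctional μ 0)
    (dualRep_whittakerFunctional_zero T)

theorem contravariantForm_lie (x : 𝔤) (m m' : T.Verma μ) :
    contravariantForm T ⁅x, m⁆ m' = contravariantForm T m ⁅T.σ x, m'⁆ := by
  rw [contravariantForm, lift_lie, dualRep_apply]

/-- Contravariance makes the kernel a `𝔤`-submodule, and it misses the generator, whose image takes
the value `1` there. -/
theorem ker_contravariantForm : LinearMap.ker (contravariantForm T (μ := μ)) = ⊥ := by
  by_contra h
  obtain ⟨v, hv, hv0⟩ := Submodule.exists_mem_ne_zero_of_ne_bot h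
  have htop := eq_top_of_lie_mem (𝔤 := 𝔤) (LinearMap.ker (contravariantForm T (μ := μ)))
    (fun x m hm => LinearMap.ext fun m' => by
      rw [contravariantForm_lie, LinearMap.mem_ker.mp hm, LinearMap.zero_apply,
        LinearMap.zero_apply]) hv hv0
  have h1 : contravariantForm T (highestWeightVector T μ) = 0 :=
    LinearMap.mem_ker.mp (htop ▸ Submodule.mem_top)
  rw [contravariantForm, lift_highestWeightVector] at h1
  have h2 := T.whittakerFunctional_highestWeightVector μ 0
  rw [h1] at h2
  exact zero_ne_one h2

/-- Elements of `𝔥` are self-adjoint for the form, since `σ` fixes them. -/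
theorem contravariantForm_eq_zero {ν ν' : Module.Dual ℂ T.h} (hν : ν ≠ ν') {m m' : T.Verma μ}
    (hm : m ∈ T.weightSpace (T.Verma μ) ν) (hm' : m' ∈ T.weightSpace (T.Verma μ) ν') :
    contravariantForm T m m' = 0 := by
  obtain ⟨x, hx⟩ : ∃ x, ν x ≠ ν' x := by
    by_contra! h
    exact hν (LinearMap.ext h)
  have h1 := contravariantForm_lie T (x : 𝔤) m m'
  rw [T.σ_h _ x.2, T.mem_weightSpace.mp hm, T.mem_weightSpace.mp hm', map_smul, map_smul,
    LinearMap.smul_apply, smul_eq_mul, smul_eq_mul] at h1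
  exact (mul_eq_mul_right_iff.mp h1).resolve_left hx

end Verma

end TriangularDecomposition

/-! ### Finite dimensionality of the weight spaces. -/

/-- If smaller summands of a direct sum already span, they are the whole summands. -/
theorem iSupIndep.eq_of_le_of_iSup_eq_top {ι α : Type*} [CompleteLattice α] [IsModularLattice α]
    {s t : ι → α} (ht : iSupIndep t) (hst : s ≤ t) (hs : ⨆ i, s i = ⊤) : s = t := by
  funext i
  refine le_antisymm (hst i) ?_
  have h1 : s i ⊔ ⨆ (j) (_ : j ≠ i), s j = ⊤ :=
    top_le_iff.mp (hs ▸ iSup_le fun j => by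
      by_cases h : j = i
      · exact h ▸ le_sup_left
      · exact le_sup_of_le_right (le_iSup₂_of_le j h le_rfl))
  have h2 : (⨆ (j) (_ : j ≠ i), s j) ⊓ t i = ⊥ :=
    ((ht i).symm.mono_left (iSup₂_mono fun j _ => hst j)).eq_bot
  calc t i = (s i ⊔ ⨆ (j) (_ : j ≠ i), s j) ⊓ t i := by rw [h1, top_inf_eq]
    _ = s i ⊔ (⨆ (j) (_ : j ≠ i), s j) ⊓ t i := sup_inf_assoc_of_le _ (hst i)
    _ ≤ s i := by rw [h2, sup_bot_eq]

namespace TriangularDecomposition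

variable {𝔤 : Type u} [LieRing 𝔤] [LieAlgebra ℂ 𝔤] (T : TriangularDecomposition 𝔤)

/-- The element of `Q₊ ∪ {0}` with given coordinates. -/
def ofCoords : (T.base →₀ ℕ) →ₗ[ℕ] Module.Dual ℂ T.h :=
  Finsupp.linearCombination ℕ (fun α : T.base => (α : Module.Dual ℂ T.h))

theorem ofCoords_injective : Function.Injective T.ofCoords :=
  T.base_linearIndependent.restrict_scalars (R := ℕ) fun a b h => by simpa using h

theorem exists_ofCoords_eq {α : Module.Dual ℂ T.h} (hα : α ∈ AddSubmonoid.closure T.base) :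
    ∃ β, T.ofCoords β = α := by
  induction hα using AddSubmonoid.closure_induction with
  | mem x hx => exact ⟨Finsupp.single ⟨x, hx⟩ 1, by simp [ofCoords]⟩
  | zero => exact ⟨0, map_zero _⟩
  | add x y _ _ hx hy =>
    obtain ⟨a, rfl⟩ := hx
    obtain ⟨b, rfl⟩ := hy
    exact ⟨a + b, map_add _ _ _⟩

/-- The root space of `𝔫₋` for the root `-α`. -/
def nNegRootSpace (α : Module.Dual ℂ T.h) : Submodule ℂ 𝔤 :=
  T.weightSpace 𝔤 (-α) ⊓ T.nNeg.toSubmodule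

theorem finiteDimensional_nNegRootSpace (α : Module.Dual ℂ T.h)
    [FiniteDimensional ℂ ↥(T.weightSpace 𝔤 α ⊓ T.nPos.toSubmodule)] :
    FiniteDimensional ℂ (T.nNegRootSpace α) := by
  have : T.nNegRootSpace α ≤
      (T.weightSpace 𝔤 α ⊓ T.nPos.toSubmodule).map (T.σ : 𝔤 →ₗ[ℂ] 𝔤) := by
    rintro x ⟨hx, hx'⟩
    refine ⟨T.σ x, ⟨?_, T.σ_mem_nPos hx'⟩, T.σ_σ x⟩
    simpa using T.σ_mem_weightSpace hx
  exact Submodule.finiteDimensional_of_le this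

theorem nNeg_le_iSup_nNegRootSpace :
    T.nNeg.toSubmodule ≤ ⨆ β ∈ {β : T.base →₀ ℕ | β ≠ 0}, T.nNegRootSpace (T.ofCoords β) := by
  rw [← T.σ_nPos, Submodule.map_le_iff_le_comap, T.nPos_eq]
  refine iSup₂_le fun α hα x hx => ?_
  obtain ⟨β, rfl⟩ := T.exists_ofCoords_eq hα.1
  refine Submodule.mem_iSup_of_mem β (Submodule.mem_iSup_of_mem ?_ ?_)
  · rintro rfl
    exact hα.2 (map_zero _)
  · exact ⟨T.σ_mem_weightSpace hx.1, T.σ_mem_nNeg hx.2⟩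

namespace Verma

variable (μ : Module.Dual ℂ T.h)

/-- The vectors `x₁ ⋯ xₙ v` for root vectors `xᵢ` of `𝔫₋`, where `v` is the highest weight
vector and the roots of the `xᵢ` add up to the given element of `-Q₊`. -/
inductive IsMonomial : (T.base →₀ ℕ) → T.Verma μ → Prop
  | highestWeightVector : IsMonomial 0 (highestWeightVector T μ)
  | lie {α β : T.base →₀ ℕ} {x : 𝔤} {m : T.Verma μ} (hα : α ≠ 0)
      (hx : x ∈ T.nNegRootSpace (T.ofCoords α)) (hm : IsMonomial β m) : IsMonomial (α + β) ⁅x, m⁆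

/-- The span of the monomials of a given weight. -/
def monomialSpan (β : T.base →₀ ℕ) : Submodule ℂ (T.Verma μ) :=
  Submodule.span ℂ {m | IsMonomial T μ β m}

theorem monomialSpan_le (β : T.base →₀ ℕ) :
    monomialSpan T μ β ≤ T.weightSpace (T.Verma μ) (μ - T.ofCoords β) := by
  refine Submodule.span_le.mpr fun m hm => ?_
  simp only [Set.mem_ofPred_eq] at hm
  induction hm with
  | highestWeightVector => simpa using highestWeightVector_mem T μ
  | @lie α β x m hα hx hm ih =>
    have := T.lie_mem_weightSpace hx.1 ih
    rwa [show -T.ofCoords α + (μ - T.ofCoords β) = μ - T.ofCoords (α + β) by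
      rw [map_add]
      abel] at this

theorem lie_mem_monomialSpan {α β : T.base →₀ ℕ} (hα : α ≠ 0) {x : 𝔤}
    (hx : x ∈ T.nNegRootSpace (T.ofCoords α)) {m : T.Verma μ} (hm : m ∈ monomialSpan T μ β) :
    ⁅x, m⁆ ∈ monomialSpan T μ (α + β) := by
  have : monomialSpan T μ β ≤ (monomialSpan T μ (α + β)).comap
      (LieModule.toEnd ℂ 𝔤 (T.Verma μ) x : T.Verma μ →ₗ[ℂ] T.Verma μ) :=
    Submodule.span_le.mpr fun m hm => Submodule.subset_span (hm.lie hα hx)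
  exact this hm

theorem iSup_monomialSpan [LieModule.IsIrreducible ℂ 𝔤 (T.Verma μ)] :
    ⨆ β, monomialSpan T μ β = ⊤ := by
  refine eq_top_of_nNeg_lie_mem T _
    (Submodule.mem_iSup_of_mem 0 (Submodule.subset_span .highestWeightVector)) fun x hx m hm => ?_
  induction hm using Submodule.iSup_induction' with
  | zero => simp
  | add a b _ _ ha hb =>
    rw [lie_add]
    exact add_mem ha hb
  | mem β m hm =>
    have : T.nNeg.toSubmodule ≤ (⨆ β, monomialSpan T μ β).comap
        ((LieModule.toEnd ℂ 𝔤 (T.Verma μ)).toLinearMap.flip m) :=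
      T.nNeg_le_iSup_nNegRootSpace.trans (iSup₂_le fun α hα y hy =>
        Submodule.mem_iSup_of_mem (α + β) (lie_mem_monomialSpan T μ hα hy hm))
    exact this hx

/-- Peeling off the leftmost root vector splits `β` as `α + γ` with `α ≠ 0`. There are finitely many
splittings, `γ` has smaller degree, and root spaces are finite dimensional, so induction on the
degree applies. -/
theorem finiteDimensional_monomialSpan
    (hfin : ∀ α : Module.Dual ℂ T.h,
      FiniteDimensional ℂ ↥(T.weightSpace 𝔤 α ⊓ T.nPos.toSubmodule)) (β : T.base →₀ ℕ) :
    FiniteDimensional ℂ (monomialSpan T μ β) := by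
  classical
  induction hn : β.degree using Nat.strong_induction_on generalizing β with
  | _ n ih =>
    subst hn
    let br : 𝔤 →ₗ[ℂ] T.Verma μ →ₗ[ℂ] T.Verma μ := (LieModule.toEnd ℂ 𝔤 (T.Verma μ)).toLinearMap
    let s := (Finset.HasAntidiagonal.antidiagonal β).filter fun p => p.1 ≠ 0
    let E : (T.base →₀ ℕ) × (T.base →₀ ℕ) → Submodule ℂ (T.Verma μ) := fun p =>
      Submodule.map₂ br (T.nNegRootSpace (T.ofCoords p.1)) (monomialSpan T μ p.2)
    have hE : (⨆ p ∈ s, E p).FG := by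
      refine Submodule.fg_biSup s E fun p hp => ?_
      obtain ⟨hp1, hp2⟩ := Finset.mem_filter.mp hp
      have hdeg : p.2.degree < β.degree := by
        rw [← Finset.HasAntidiagonal.mem_antidiagonal.mp hp1, map_add]
        have := (Finsupp.degree_eq_zero_iff p.1).not.mpr hp2
        omega
      have h1 := ih _ hdeg p.2 rfl
      have h2 := T.finiteDimensional_nNegRootSpace (T.ofCoords p.1)
      exact Submodule.FG.map₂ br (Module.Finite.iff_fg.mp h2) (Module.Finite.iff_fg.mp h1)
    have hfg := (Submodule.fg_span_singleton (R := ℂ) (highestWeightVector T μ)).sup hE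
    -- The line of the generator is needed only for `β = 0`; adding it for every `β` avoids a case
    -- distinction.
    have hle : monomialSpan T μ β ≤ Submodule.span ℂ {highestWeightVector T μ} ⊔ ⨆ p ∈ s, E p := by
      refine Submodule.span_le.mpr fun m hm => ?_
      rcases hm with _ | @⟨α, γ, x, m, hα, hx, hm⟩
      · exact Submodule.mem_sup_left (Submodule.mem_span_singleton_self _)
      · refine Submodule.mem_sup_right (Submodule.mem_iSup_of_mem (α, γ)
          (Submodule.mem_iSup_of_mem ?_ ?_))
        · exact Finset.mem_filter.mpr ⟨Finset.HasAntidiagonal.mem_antidiagonal.mpr rfl, hα⟩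
        · exact Submodule.apply_mem_map₂ br hx (Submodule.subset_span hm)
    have := Module.Finite.iff_fg.mpr hfg
    exact Submodule.finiteDimensional_of_le hle

variable [LieModule.IsIrreducible ℂ 𝔤 (T.Verma μ)]

/-- The monomial spans lie in weight spaces and together fill the module, so independence of the
weight spaces forces equality. Linear independence of the base leaves at most one `β` for each `ν`.
-/
theorem finiteDimensional_weightSpace
    (hfin : ∀ α : Module.Dual ℂ T.h,
      FiniteDimensional ℂ ↥(T.weightSpace 𝔤 α ⊓ T.nPos.toSubmodule)) (ν : Module.Dual ℂ T.h) :
    FiniteDimensional ℂ (T.weightSpace (T.Verma μ) ν) := by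
  let E : Module.Dual ℂ T.h → Submodule ℂ (T.Verma μ) := fun ν =>
    ⨆ (β) (_ : μ - T.ofCoords β = ν), monomialSpan T μ β
  have hE : E = fun ν => T.weightSpace (T.Verma μ) ν := by
    refine (T.iSupIndep_weightSpace (T.Verma μ)).eq_of_le_of_iSup_eq_top
      (fun ν => iSup₂_le fun β hβ => hβ ▸ monomialSpan_le T μ β) ?_
    exact top_le_iff.mp (iSup_monomialSpan T μ ▸ iSup_le fun β =>
      le_iSup_of_le (μ - T.ofCoords β) (le_iSup₂_of_le β rfl le_rfl))
  rw [← congrFun hE ν]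
  by_cases h : ∃ β, μ - T.ofCoords β = ν
  · obtain ⟨β, rfl⟩ := h
    have hle : E (μ - T.ofCoords β) ≤ monomialSpan T μ β := iSup₂_le fun γ hγ =>
      (T.ofCoords_injective (sub_right_injective hγ)) ▸ le_rfl
    have := finiteDimensional_monomialSpan T μ hfin β
    exact Submodule.finiteDimensional_of_le hle
  · have hbot : E ν = ⊥ := eq_bot_iff.mpr (iSup₂_le fun γ hγ => (h ⟨γ, hγ⟩).elim)
    rw [hbot]
    infer_instance

end Verma

end TriangularDecomposition

/-! ### The completion as the full dual, and its Whittaker vectors. -/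

namespace TriangularDecomposition

variable {𝔤 : Type u} [LieRing 𝔤] [LieAlgebra ℂ 𝔤] (T : TriangularDecomposition 𝔤)

/-- The character `x ↦ χ(σ(x))` of `𝔫₋`. -/
def oppositeCharacter (χ : LieAlgebra.LieCharacter ℂ T.nPos) :
    LieAlgebra.LieCharacter ℂ T.nNeg where
  toFun x := χ ⟨T.σ x, T.σ_mem_nPos x.2⟩
  map_add' x y := by
    rw [← map_add]
    congr 1
    exact Subtype.ext (map_add T.σ (x : 𝔤) y)
  map_smul' c x := by
    rw [RingHom.id_apply, ← map_smul]
    congr 1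
    exact Subtype.ext (map_smul T.σ c (x : 𝔤))
  map_lie' {x y} := by
    have h : (⟨T.σ (⁅x, y⁆ : T.nNeg), T.σ_mem_nPos (⁅x, y⁆ : T.nNeg).2⟩ : T.nPos) =
        ⁅(⟨T.σ y, T.σ_mem_nPos y.2⟩ : T.nPos), (⟨T.σ x, T.σ_mem_nPos x.2⟩ : T.nPos)⁆ :=
      Subtype.ext (T.σ_lie x y)
    -- The reversal of brackets by `σ` is harmless, as a character vanishes on brackets.
    simp only [h, LieAlgebra.lieCharacter_apply_lie]
    rw [LieRing.of_associative_ring_bracket, mul_comm, sub_self]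

namespace Verma

variable {μ : Module.Dual ℂ T.h} [LieModule.IsIrreducible ℂ 𝔤 (T.Verma μ)]

open scoped Classical in
theorem isInternal_weightSpace :
    DirectSum.IsInternal (fun ν => T.weightSpace (T.Verma μ) ν) :=
  DirectSum.isInternal_submodule_of_iSupIndep_of_iSup_eq_top
    (T.iSupIndep_weightSpace (T.Verma μ)) (iSup_weightSpace T)

theorem dual_ext {F G : Module.Dual ℂ (T.Verma μ)}
    (h : ∀ ν, ∀ m ∈ T.weightSpace (T.Verma μ) ν, F m = G m) : F = G := by
  have htop : LinearMap.eqLocus F G = ⊤ :=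
    top_le_iff.mp (iSup_weightSpace T (μ := μ) ▸ iSup_le fun ν m hm => h ν m hm)
  exact LinearMap.ext fun m => (htop ▸ Submodule.mem_top : m ∈ LinearMap.eqLocus F G)

open scoped Classical in
/-- The weight space decomposition of a simple Verma module. -/
def weightDecomposition :
    (DirectSum (Module.Dual ℂ T.h) fun ν => T.weightSpace (T.Verma μ) ν) ≃ₗ[ℂ] T.Verma μ :=
  LinearEquiv.ofBijective (DirectSum.coeLinearMap fun ν => T.weightSpace (T.Verma μ) ν)
    (isInternal_weightSpace T)

open scoped Classical in
theorem weightDecomposition_symm_apply {ν : Module.Dual ℂ T.h} {m : T.Verma μ}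
    (hm : m ∈ T.weightSpace (T.Verma μ) ν) :
    (weightDecomposition T).symm m =
      DirectSum.lof ℂ (Module.Dual ℂ T.h) (fun ν => T.weightSpace (T.Verma μ) ν) ν ⟨m, hm⟩ := by
  rw [LinearEquiv.symm_apply_eq]
  exact (DirectSum.coeLinearMap_lof (fun ν => T.weightSpace (T.Verma μ) ν) ν ⟨m, hm⟩).symm

open scoped Classical in
/-- The linear functional on a simple Verma module defined by an element of the completion, by
means of the contravariant form. -/
def completionFunctional (f : T.Completion (T.Verma μ)) : Module.Dual ℂ (T.Verma μ) :=
  -- `f` may have infinitely many nonzero components, but a vector of `M(μ)` has finitely many. Only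
  -- equal weights are paired, the others being orthogonal.
  DirectSum.toModule ℂ (Module.Dual ℂ T.h) ℂ
      (fun ν => contravariantForm T (f ν) ∘ₗ (T.weightSpace (T.Verma μ) ν).subtype) ∘ₗ
    (weightDecomposition T).symm.toLinearMap

theorem completionFunctional_apply (f : T.Completion (T.Verma μ)) {ν : Module.Dual ℂ T.h}
    {m : T.Verma μ} (hm : m ∈ T.weightSpace (T.Verma μ) ν) :
    completionFunctional T f m = contravariantForm T (f ν : T.Verma μ) m := by
  classical
  rw [completionFunctional, LinearMap.comp_apply, LinearEquiv.coe_coe,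
    weightDecomposition_symm_apply T hm, DirectSum.toModule_lof]
  rfl

/-- The pairing of the completion of a simple Verma module with the Verma module which is induced
by the contravariant form. -/
def completionPairing : T.Completion (T.Verma μ) →ₗ[ℂ] Module.Dual ℂ (T.Verma μ) where
  toFun := completionFunctional T
  map_add' f g := dual_ext T fun ν m hm => by
    rw [LinearMap.add_apply, completionFunctional_apply T _ hm, completionFunctional_apply T _ hm,
      completionFunctional_apply T _ hm, ← LinearMap.add_apply, ← map_add]
    rfl
  map_smul' c f := dual_ext T fun ν m hm => by
    rw [LinearMap.smul_apply, completionFunctional_apply T _ hm,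
      completionFunctional_apply T _ hm, RingHom.id_apply, ← LinearMap.smul_apply, ← map_smul]
    rfl

theorem completionPairing_apply (f : T.Completion (T.Verma μ)) {ν : Module.Dual ℂ T.h}
    {m : T.Verma μ} (hm : m ∈ T.weightSpace (T.Verma μ) ν) :
    completionPairing T f m = contravariantForm T (f ν : T.Verma μ) m :=
  completionFunctional_apply T f hm

/-- For a root vector `x` of weight `α`, `σ x` shifts weights by `-α`, which matches the index `ν -
α` in the action on the completion. Contravariance then applies componentwise. -/
theorem completionPairing_lie (x : 𝔤) (f : T.Completion (T.Verma μ)) (m : T.Verma μ) :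
    completionPairing T ⁅x, f⁆ m = completionPairing T f ⁅T.σ x, m⁆ := by
  classical
  have hx : x ∈ ⨆ α, T.weightSpace 𝔤 α :=
    T.isInternal_weightSpace.submodule_iSup_eq_top ▸ Submodule.mem_top
  induction hx using Submodule.iSup_induction' with
  | zero => simp
  | add a b _ _ ha hb => simp [ha, hb]
  | mem α x hx =>
    suffices h : completionPairing T ⁅x, f⁆ =
        completionPairing T f ∘ₗ LieModule.toEnd ℂ 𝔤 (T.Verma μ) (T.σ x) from
      DFunLike.congr_fun h m
    refine dual_ext T fun ν m hm => ?_
    have h1 : ((⁅x, f⁆ : T.Completion (T.Verma μ)) ν : T.Verma μ) = ⁅x, (f (ν - α) : T.Verma μ)⁆ :=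
      Completion.action_apply T (T.Verma μ) hx f ν
    have h2 : ⁅T.σ x, m⁆ ∈ T.weightSpace (T.Verma μ) (ν - α) := by
      have := T.lie_mem_weightSpace (T.σ_mem_weightSpace hx) hm
      rwa [neg_add_eq_sub] at this
    rw [completionPairing_apply T _ hm, h1, contravariantForm_lie]
    exact (completionPairing_apply T f h2).symm

theorem completionPairing_injective : Function.Injective (completionPairing T (μ := μ)) := by
  rw [injective_iff_map_eq_zero]
  intro f hf
  refine funext fun ν => Subtype.ext ?_
  have h1 : contravariantForm T (f ν : T.Verma μ) = 0 := by
    refine dual_ext T fun ν' m hm => ?_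
    by_cases h : ν = ν'
    · subst h
      rw [← completionPairing_apply T f hm, hf]
    · exact contravariantForm_eq_zero T h (f ν).2 hm
  exact (LinearMap.ker_eq_bot'.mp (ker_contravariantForm T)) _ h1

/-- The form restricted to each weight space is injective into the dual, hence onto by finite
dimension. The components can be chosen independently because the completion is a full product. -/
theorem completionPairing_surjective
    (hfin : ∀ α : Module.Dual ℂ T.h,
      FiniteDimensional ℂ ↥(T.weightSpace 𝔤 α ⊓ T.nPos.toSubmodule)) :
    Function.Surjective (completionPairing T (μ := μ)) := by
  intro F
  have key : ∀ ν, ∃ v : T.weightSpace (T.Verma μ) ν, ∀ m ∈ T.weightSpace (T.Verma μ) ν,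
      contravariantForm T (v : T.Verma μ) m = F m := by
    intro ν
    have := finiteDimensional_weightSpace T μ hfin ν
    let θ : T.weightSpace (T.Verma μ) ν →ₗ[ℂ] Module.Dual ℂ (T.weightSpace (T.Verma μ) ν) :=
      (contravariantForm T).domRestrict₁₂ _ _
    have hθ : Function.Injective θ := by
      rw [injective_iff_map_eq_zero]
      intro v hv
      refine Subtype.ext ((LinearMap.ker_eq_bot'.mp (ker_contravariantForm T)) _ ?_)
      refine dual_ext T fun ν' m hm => ?_
      by_cases h : ν = ν'
      · subst h
        exact DFunLike.congr_fun hv ⟨m, hm⟩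
      · exact contravariantForm_eq_zero T h v.2 hm
    obtain ⟨v, hv⟩ := (LinearMap.injective_iff_surjective_of_finrank_eq_finrank
      Subspace.dual_finrank_eq.symm).mp hθ (F ∘ₗ (T.weightSpace (T.Verma μ) ν).subtype)
    exact ⟨v, fun m hm => DFunLike.congr_fun hv ⟨m, hm⟩⟩
  choose f hf using key
  exact ⟨f, dual_ext T fun ν m hm => 
    (completionPairing_apply T _ hm).trans (hf ν m hm)⟩

theorem mem_whittakerVectors_iff {χ : LieAlgebra.LieCharacter ℂ T.nPos}
    {f : T.Completion (T.Verma μ)} :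
    f ∈ whittakerVectors T.nPos χ (T.Completion (T.Verma μ)) ↔
      ∀ (x : T.nPos) (m : T.Verma μ),
        completionPairing T f ⁅T.σ x, m⁆ = χ x * completionPairing T f m := by
  change (∀ x : T.nPos, ⁅(x : 𝔤), f⁆ = χ x • f) ↔ _
  refine forall_congr' fun x => ?_
  rw [← (completionPairing_injective T).eq_iff, map_smul, LinearMap.ext_iff]
  simp only [completionPairing_lie, LinearMap.smul_apply, smul_eq_mul]

/-- The value of the functional given by a Whittaker vector at the highest weight vector. -/
def whittakerEval (χ : LieAlgebra.LieCharacter ℂ T.nPos) :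
    whittakerVectors T.nPos χ (T.Completion (T.Verma μ)) →ₗ[ℂ] ℂ :=
  (LinearMap.applyₗ (highestWeightVector T μ) ∘ₗ completionPairing T) ∘ₗ
    (whittakerVectors T.nPos χ (T.Completion (T.Verma μ))).toSubmodule.subtype

/-- The kernel of the functional of a Whittaker vector is `𝔫₋`-stable; if it contains the generator,
it is everything. -/
theorem whittakerEval_injective (χ : LieAlgebra.LieCharacter ℂ T.nPos) :
    Function.Injective (whittakerEval T (μ := μ) χ) := by
  rw [injective_iff_map_eq_zero]
  intro f hf
  have hf' := (mem_whittakerVectors_iff T).mp f.2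
  refine Subtype.ext (completionPairing_injective T ?_)
  have htop : LinearMap.ker (completionPairing T (f : T.Completion (T.Verma μ))) = ⊤ := by
    refine eq_top_of_nNeg_lie_mem T _ hf fun x hx m hm => ?_
    obtain ⟨y, hy, rfl⟩ := T.exists_σ_eq_of_mem_nNeg hx
    rw [LinearMap.mem_ker] at hm ⊢
    rw [hf' ⟨y, hy⟩, hm, mul_zero]
  exact (LinearMap.ker_eq_top.mp htop).trans (map_zero _).symm

theorem whittakerEval_surjective
    (hfin : ∀ α : Module.Dual ℂ T.h,
      FiniteDimensional ℂ ↥(T.weightSpace 𝔤 α ⊓ T.nPos.toSubmodule))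
    (χ : LieAlgebra.LieCharacter ℂ T.nPos) :
    Function.Surjective (whittakerEval T (μ := μ) χ) := by
  intro c
  -- The preimage of the functional of `χ ∘ σ`, scaled by `c` since that functional is `1` at the
  -- generator.
  obtain ⟨f, hf⟩ := completionPairing_surjective T hfin
    (c • T.whittakerFunctional μ (T.oppositeCharacter χ))
  refine ⟨⟨f, (mem_whittakerVectors_iff T).mpr fun x m => ?_⟩, ?_⟩
  · have h1 := T.whittakerFunctional_lie μ (T.oppositeCharacter χ) ⟨T.σ x, T.σ_mem_nNeg x.2⟩ m
    have h2 : T.oppositeCharacter χ ⟨T.σ x, T.σ_mem_nNeg x.2⟩ = χ x :=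
      congrArg χ (Subtype.ext (T.σ_σ x))
    rw [h2] at h1
    simp only [hf, LinearMap.smul_apply, smul_eq_mul, h1]
    ring
  · change completionPairing T f (highestWeightVector T μ) = c
    rw [hf, LinearMap.smul_apply, whittakerFunctional_highestWeightVector, smul_eq_mul, mul_one]

end Verma

end TriangularDecomposition

end

/-- A one-dimensional module of a Lie algebra is irreducible. -/
theorem LieModule.isIrreducible_of_finrank_eq_one {K L M : Type*} [Field K] [LieRing L]
    [LieAlgebra K L] [AddCommGroup M] [Module K M] [LieRingModule L M] [LieModule K L M]
    (h : Module.finrank K M = 1) : LieModule.IsIrreducible K L M := by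
  have : Nontrivial M := Module.nontrivial_of_finrank_pos (R := K) (h ▸ one_pos)
  refine LieModule.IsIrreducible.mk fun N hN => ?_
  obtain ⟨v, hv, hv0⟩ := Submodule.exists_mem_ne_zero_of_ne_bot
    ((LieSubmodule.toSubmodule_eq_bot N).not.mpr hN)
  refine top_le_iff.mp fun w _ => ?_
  obtain ⟨c, rfl⟩ := (finrank_eq_one_iff_of_nonzero' v hv0).mp h w
  exact N.smul_mem c hv

/-- Whittaker vectors in the completion of a simple Verma module. -/
theorem theorem45 {𝔤 : Type*} [LieRing 𝔤] [LieAlgebra ℂ 𝔤] (T : TriangularDecomposition 𝔤)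
    (hfin : ∀ α : Module.Dual ℂ T.h,
      FiniteDimensional ℂ ↥(T.weightSpace 𝔤 α ⊓ T.nPos.toSubmodule))
    (μ : Module.Dual ℂ T.h) (hμ : LieModule.IsIrreducible ℂ 𝔤 (T.Verma μ))
    (χ : LieAlgebra.LieCharacter ℂ T.nPos) :
    Module.finrank ℂ (whittakerVectors T.nPos χ (T.Completion (T.Verma μ))) = 1 ∧
      LieModule.IsIrreducible ℂ T.nPos
        (whittakerVectors T.nPos χ (T.Completion (T.Verma μ))) := by
  have h1 : Module.finrank ℂ (whittakerVectors T.nPos χ (T.Completion (T.Verma μ))) = 1 := by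
    rw [← Module.finrank_self ℂ]
    exact (LinearEquiv.ofBijective (TriangularDecomposition.Verma.whittakerEval T χ)
      ⟨TriangularDecomposition.Verma.whittakerEval_injective T χ,
        TriangularDecomposition.Verma.whittakerEval_surjective T hfin χ⟩).finrank_eq
  exact ⟨h1, LieModule.isIrreducible_of_finrank_eq_one h1⟩
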